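/- For a real random variable \(X\) write \(F_X\) for its distribution function and \(\mathrm{VaR}_\alpha(X)=\inf\{x\in\mathbb R: F_X(x)\ge\alpha\}\). For \(\alpha,\beta\in(0,1)\) let \(\mathrm{CoVaR}_{\alpha,\beta}(Y|X)\) be the \(\beta\)-quantile \(\inf\{y\in\mathbb R:\mathbb P(Y\le y\mid X\ge \mathrm{VaR}_\alpha(X))\ge\beta\}\) of the conditional distribution of \(Y\) given \(X\ge\mathrm{VaR}_\alpha(X)\). Write \((X,Y)\sim\mathcal E(\mu,\Sigma,R)\) if \((X,Y)^\top\) has the law of \(\mu+RAW\), where \(\mu=(\mu_X,\mu_Y)\in\mathbb R^2\), \(W\) is uniformly distributed on the Euclidean unit circle of \(\mathbb R^2\), \(R\ge0\) is a random variable independent of \(W\), and \(A\in\mathbb R^{2\times2}\) satisfies \[AA^\top=\Sigma=\begin{pmatrix}\sigma_X^2&\sigma_X\sigma_Y\rho\\ \sigma_X\sigma_Y\rho&\sigma_Y^2\end{pmatrix},\qquad \sigma_X,\sigma_Y\ge0 .\] A copula is a function \(C\) on \([0,1]^2\) that is the joint distribution function of two random variables uniformly distributed on \((0,1)\); it is a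 copula of \((X,Y)\) if \(\mathbb P(X\le x,Y\le y)=C(F_X(x),F_Y(y))\) for all \(x,y\in\mathbb R\). An elliptical copula with dependence parameter \(\rho\) and type \(R\) is the copula of a vector with distribution \(\mathcal E(\mu,\Sigma,R)\) and continuous margins, where \(\Sigma\) has dependence parameter \(\rho\); two elliptical copulas are of the same type if their radial parts \(R\) have the same law. **Theorem.** Let \((X,Y)\) and \((X',Y')\) be bivariate random vectors such that \(F_X\) and \(F_{X'}\) are continuous, and let \(\rho\le\rho'\). (a) If \((X,Y)\sim\mathcal E(\mu,\Sigma,R)\) and \((X',Y')\sim\mathcal E(\mu',\Sigma',R)\) have dependence parameters \(\rho\) and \(\rho'\), respectively, and if \(\mu_Y\le\mu_{Y'}\) and \(\sigma_Y=\sigma_{Y'}\), then \[\mathrm{CoVaR}_{\alpha,\beta}(Y|X)\le\mathrm{CoVaR}_{\alpha,\beta}(Y'|X')\qquad\text{for all }\alpha,\beta\in(0,1).\tag{1}\] (b) If \((X,Y)\sim\mathcal E(\mu,\Sigma,R)\) and \((X',Y')\sim\mathcal E(\mu',\Sigma',R)\) have dependence parameters \(\rho\) and \(\rho'\), respectively,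 and if \(\mu_Y\le\mu_{Y'}\) and \(\sigma_Y\le\sigma_{Y'}\), then \[\mathrm{CoVaR}_{\alpha,\beta}(Y|X)\le\mathrm{CoVaR}_{\alpha,\beta}(Y'|X')\qquad\text{for all }\alpha,\beta\in(0,1)\text{ with }\beta\ge\beta_0:=\frac{1/2-C(\alpha,1/2)}{1-\alpha},\] where \(C\) is the copula of \((X,Y)\) (if \(\sigma_Y=0\), in which case the copula of \((X,Y)\) is not unique, \(C\) is the elliptical copula with dependence parameter \(\rho\) and type \(R\)). (c) If \((X,Y)\) and \((X',Y')\) have elliptical copulas of the same type with dependence parameters \(\rho\) and \(\rho'\), respectively, and if \(F_Y(y)\ge F_{Y'}(y)\) for all \(y\in\mathbb R\), then (1) holds. -/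

import Mathlib

open MeasureTheory ProbabilityTheory

noncomputable section

/-- The Value-at-Risk of `X` at level `α`: the generalized inverse
`inf {x : F_X(x) ≥ α}` of the distribution function of `X` under `P`. -/
def VaR {Ω : Type*} [MeasurableSpace Ω] (P : Measure Ω) (X : Ω → ℝ) (α : ℝ) : ℝ :=
  sInf {x : ℝ | α ≤ cdf (P.map X) x}

/-- `CoVaR_{α,β}(Y|X)`: the Value-at-Risk of `Y` at level `β` under the conditional probability
measure given the event `{X ≥ VaR_α(X)}`. -/
def CoVaR {Ω : Type*} [MeasurableSpace Ω] (P : Measure Ω) (Y X : Ω → ℝ) (α β : ℝ) : ℝ :=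
  VaR (P[|{ω | VaR P X α ≤ X ω}]) Y β

/-- The uniform distribution on the Euclidean unit circle of the plane: the law of
`(cos θ, sin θ)` for an angle `θ` that is uniformly distributed on `(-π, π]`. -/
def circleUniform : Measure (ℝ × ℝ) :=
  ((volume : Measure ℝ)[|Set.Ioc (-Real.pi) Real.pi]).map fun θ => (Real.cos θ, Real.sin θ)

/-- The law of the vector `m + R A W`, where the radial part `R` has law `ν` and is independent
of the vector `W`, which is uniformly distributed on the unit circle. -/
def ellipticalLaw (m : ℝ × ℝ) (A : Matrix (Fin 2) (Fin 2) ℝ) (ν : Measure ℝ) :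
    Measure (ℝ × ℝ) :=
  (ν.prod circleUniform).map fun p =>
    (m.1 + p.1 * (A 0 0 * p.2.1 + A 0 1 * p.2.2), m.2 + p.1 * (A 1 0 * p.2.1 + A 1 1 * p.2.2))

/-- The ellipticity matrix with scale parameters `σX`, `σY` and dependence parameter `ρ`. -/
def ellipticityMatrix (σX σY ρ : ℝ) : Matrix (Fin 2) (Fin 2) ℝ :=
  !![σX ^ 2, σX * σY * ρ; σX * σY * ρ, σY ^ 2]

/-- The law `κ` on the plane is the bivariate elliptical distribution with location parameter
`(μX, μY)`, with ellipticity matrix `A Aᵀ` given by the scale parameters `σX, σY ≥ 0` and the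
dependence parameter `ρ`, and with radial part distributed according to `ν`. -/
def IsElliptical (κ : Measure (ℝ × ℝ)) (μX μY σX σY ρ : ℝ) (ν : Measure ℝ) : Prop :=
  0 ≤ σX ∧ 0 ≤ σY ∧ ∃ A : Matrix (Fin 2) (Fin 2) ℝ,
    A * A.transpose = ellipticityMatrix σX σY ρ ∧ κ = ellipticalLaw (μX, μY) A ν

/-- `C` is, on the unit square, the joint distribution function of a probability law on the plane
both of whose margins are uniform on the unit interval. -/
def IsCopula (C : ℝ → ℝ → ℝ) : Prop :=
  ∃ τ : Measure (ℝ × ℝ), IsProbabilityMeasure τ ∧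
    τ.fst = (volume : Measure ℝ).restrict (Set.Icc 0 1) ∧
    τ.snd = (volume : Measure ℝ).restrict (Set.Icc 0 1) ∧
    ∀ u ∈ Set.Icc (0 : ℝ) 1, ∀ v ∈ Set.Icc (0 : ℝ) 1,
      C u v = τ.real (Set.Iic u ×ˢ Set.Iic v)

/-- `C` is a copula of the law `κ` on the plane: the joint distribution function of `κ` is
obtained by inserting the two marginal distribution functions into `C`. -/
def IsCopulaOf (C : ℝ → ℝ → ℝ) (κ : Measure (ℝ × ℝ)) : Prop :=
  IsCopula C ∧ ∀ x y : ℝ, κ.real (Set.Iic x ×ˢ Set.Iic y) = C (cdf κ.fst x) (cdf κ.snd y)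

/-- `C` is an elliptical copula with dependence parameter `ρ` and of the type given by the law `ν`
of the radial part: it is a copula of an elliptical distribution with these parameters whose
margins are continuous. -/
def IsEllipticalCopula (C : ℝ → ℝ → ℝ) (ρ : ℝ) (ν : Measure ℝ) : Prop :=
  ∃ (κ : Measure (ℝ × ℝ)) (μX μY σX σY : ℝ), IsElliptical κ μX μY σX σY ρ ν ∧
    Continuous (cdf κ.fst) ∧ Continuous (cdf κ.snd) ∧ IsCopulaOf C κ

end

/-!
The radial vector `R W` has a reflection-invariant law, so everything reduces to the joint
distribution function `projCdf ν u v x y = ℙ(⟨u, R W⟩ ≤ x, ⟨v, R W⟩ ≤ y)` for unit vectors `u, v`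
with `⟨u, v⟩ = ρ`, which describes the standardized pair `(X, Y)`.

The heart of the matter is that this function increases with `ρ` (`projCdf_le`). To replace `v` by
`v'` with `⟨u, v⟩ ≤ ⟨u, v'⟩`, consider the reflection `s` that exchanges `v` and `v'`. Summing
over `w` and `s w`, the difference of the indicators of the two events becomes
`(1[⟨u, w⟩ ≤ x] - 1[⟨u, s w⟩ ≤ x]) * (1[⟨v', w⟩ ≤ y] - 1[⟨v, w⟩ ≤ y])`, and both factors have the
same sign, because `⟨u, w⟩ - ⟨u, s w⟩` and `⟨v', w⟩ - ⟨v, w⟩` do (`planeDot_swap_mul_nonneg`).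

If `F_X` is continuous and `F_X(x) = α`, then the conditional distribution function of `Y` is
`y ↦ (F_Y(y) - ℙ(X ≤ x, Y ≤ y)) / (1 - α)` (`cdf_cond_VaR_le`). Hence a larger `ρ` makes it smaller
and the conditional quantiles larger, which settles the case of equal scales. In terms of a copula
the numerator is `v - C(α, v)` at `v = F_Y(y)`; it is increasing in `v` and, as `C` increases with
`ρ`, decreasing in `ρ`, which settles the case of elliptical copulas.

For ordered scales, `μ_Y + σ_Y z ≤ μ_{Y'} + σ_{Y'} z` is needed at the standardized conditional
quantile `z`, that is, `0 ≤ z`. The level `β₀` is the value of the conditional distribution function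
at the median, which corresponds to `z = 0`. So `0 ≤ z` is immediate for `β > β₀`; for `β = β₀` the
conditional distribution function must not be constant on an interval to the left of the median.
For fixed `R`, the condition on `X` restricts `W` to an arc about the direction `u`, and
connectedness of the arc shows that constancy would force one and the same sign of the second
projection on all these arcs (`sinusoid_sign_of_null`), hence `β₀ = 0` or `β₀ = 1`
(`eq_zero_or_eq_of_flat`).
-/


/-! ### Reflections of the plane and the law of the radial vector -/

/-- The Euclidean inner product of two vectors of the plane `ℝ × ℝ` (whose norm in Mathlib is the
maximum norm). -/
def planeDot (u w : ℝ × ℝ) : ℝ := u.1 * w.1 + u.2 * w.2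

/-- The map `w ↦ c * conj w` in complex notation. For a unit vector `c` these are exactly the
reflections of the plane in lines through the origin. -/
def planeReflection (c w : ℝ × ℝ) : ℝ × ℝ := (c.1 * w.1 + c.2 * w.2, c.2 * w.1 - c.1 * w.2)

/-- The parameter `c = v * v'` (a complex product) of the reflection that exchanges two unit
vectors `v` and `v'`. -/
def swapParam (v v' : ℝ × ℝ) : ℝ × ℝ := (v.1 * v'.1 - v.2 * v'.2, v.1 * v'.2 + v.2 * v'.1)

/-- The law of the vector `R W`, where `R` has law `ν` and is independent of the vector `W`, which
is uniformly distributed on the unit circle. -/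
noncomputable def radialLaw (ν : Measure ℝ) : Measure (ℝ × ℝ) :=
  (ν.prod circleUniform).map fun p => (p.1 * p.2.1, p.1 * p.2.2)

lemma measurable_planeDot (u : ℝ × ℝ) : Measurable (planeDot u) := by
  unfold planeDot; fun_prop

lemma measurable_planeReflection (c : ℝ × ℝ) : Measurable (planeReflection c) := by
  unfold planeReflection; fun_prop

lemma planeDot_planeReflection (c u w : ℝ × ℝ) :
    planeDot u (planeReflection c w) = planeDot (planeReflection c u) w := by
  simp only [planeDot, planeReflection]; ring

lemma planeDot_swapParam {v v' : ℝ × ℝ} (hv : planeDot v v = 1) (hv' : planeDot v' v' = 1) :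
    planeDot (swapParam v v') (swapParam v v') = 1 := by
  simp only [planeDot, swapParam] at *
  linear_combination hv + (v.1 * v.1 + v.2 * v.2) * hv'

lemma planeReflection_swapParam_left {v v' : ℝ × ℝ} (hv : planeDot v v = 1) :
    planeReflection (swapParam v v') v = v' := by
  simp only [planeDot, swapParam, planeReflection] at *
  ext
  · linear_combination v'.1 * hv
  · linear_combination v'.2 * hv

lemma planeReflection_swapParam_right {v v' : ℝ × ℝ} (hv' : planeDot v' v' = 1) :
    planeReflection (swapParam v v') v' = v := by
  simp only [planeDot, swapParam, planeReflection] at *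
  ext
  · linear_combination v.1 * hv'
  · linear_combination v.2 * hv'

lemma planeDot_planeReflection_self {c : ℝ × ℝ} (hc : planeDot c c = 1) (u v : ℝ × ℝ) :
    planeDot (planeReflection c u) (planeReflection c v) = planeDot u v := by
  simp only [planeDot, planeReflection] at *
  linear_combination (u.1 * v.1 + u.2 * v.2) * hc

instance isProbabilityMeasure_cond_angle :
    IsProbabilityMeasure ((volume : Measure ℝ)[|Set.Ioc (-Real.pi) Real.pi]) :=
  cond_isProbabilityMeasure_of_finite (by simp [Real.pi_pos]) (by simp)

instance isProbabilityMeasure_circleUniform : IsProbabilityMeasure circleUniform :=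
  Measure.isProbabilityMeasure_map (by fun_prop)

instance isProbabilityMeasure_radialLaw (ν : Measure ℝ) [IsProbabilityMeasure ν] :
    IsProbabilityMeasure (radialLaw ν) :=
  Measure.isProbabilityMeasure_map (by fun_prop)

/-- For a `2 * π`-periodic set of angles, the measure of the part in one period is invariant under
`θ ↦ γ - θ`. -/
lemma volume_Ioc_inter_preimage_sub_left {T : Set ℝ} (hT : MeasurableSet T)
    (hper : ∀ θ, θ + 2 * Real.pi ∈ T ↔ θ ∈ T) (γ : ℝ) :
    volume (Set.Ioc (-Real.pi) Real.pi ∩ {θ | γ - θ ∈ T}) =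
      volume (Set.Ioc (-Real.pi) Real.pi ∩ T) := by
  have key : ∀ S : Set ℝ, MeasurableSet S →
      volume.real (Set.Ioc (-Real.pi) Real.pi ∩ S) =
        ∫ θ in (-Real.pi)..Real.pi, S.indicator (1 : ℝ → ℝ) θ := by
    intro S hS
    rw [intervalIntegral.integral_of_le (by linarith [Real.pi_pos]), integral_indicator_one hS,
      measureReal_restrict_apply hS, Set.inter_comm]
  have hp : Function.Periodic (T.indicator (1 : ℝ → ℝ)) (2 * Real.pi) := by
    intro θ
    by_cases h : θ ∈ T
    · rw [Set.indicator_of_mem h, Set.indicator_of_mem ((hper θ).2 h)]; rfl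
    · rw [Set.indicator_of_notMem h, Set.indicator_of_notMem (mt (hper θ).1 h)]
  have hS : MeasurableSet {θ | γ - θ ∈ T} := (measurable_const.sub measurable_id) hT
  have hfin : ∀ S : Set ℝ, volume (Set.Ioc (-Real.pi) Real.pi ∩ S) ≠ ⊤ := fun S =>
    ne_top_of_le_ne_top (by simp) (measure_mono Set.inter_subset_left)
  rw [← measureReal_eq_measureReal_iff (hfin _) (hfin _), key _ hS, key _ hT]
  have h1 : ∀ θ, Set.indicator {θ | γ - θ ∈ T} (1 : ℝ → ℝ) θ =
      T.indicator (1 : ℝ → ℝ) (γ - θ) := fun θ => rfl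
  simp_rw [h1]
  rw [intervalIntegral.integral_comp_sub_left (fun θ => T.indicator (1 : ℝ → ℝ) θ) γ]
  have h2 := hp.intervalIntegral_add_eq (γ - Real.pi) (-Real.pi)
  rwa [show γ - Real.pi + 2 * Real.pi = γ - -Real.pi by ring,
    show -Real.pi + 2 * Real.pi = Real.pi by ring] at h2

lemma circleUniform_map_planeReflection {c : ℝ × ℝ} (hc : planeDot c c = 1) :
    circleUniform.map (planeReflection c) = circleUniform := by
  obtain ⟨γ, h1, h2⟩ : ∃ γ : ℝ, c.1 = Real.cos γ ∧ c.2 = Real.sin γ := by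
    have hn : ‖(⟨c.1, c.2⟩ : ℂ)‖ = 1 := by
      rw [Complex.norm_def, Complex.normSq_mk]
      simp only [planeDot] at hc
      rw [hc, Real.sqrt_one]
    have h0 : (⟨c.1, c.2⟩ : ℂ) ≠ 0 := by
      intro h; rw [h] at hn; simp at hn
    refine ⟨Complex.arg ⟨c.1, c.2⟩, ?_, ?_⟩
    · rw [Complex.cos_arg h0, hn]; simp
    · rw [Complex.sin_arg, hn]; simp
  ext s hs
  have hm : Measurable fun θ : ℝ => (Real.cos θ, Real.sin θ) := by fun_prop
  rw [Measure.map_apply (measurable_planeReflection c) hs, circleUniform,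
    Measure.map_apply hm (measurable_planeReflection c hs), Measure.map_apply hm hs,
    cond_apply measurableSet_Ioc, cond_apply measurableSet_Ioc]
  congr 1
  rw [← volume_Ioc_inter_preimage_sub_left (hm hs) _ γ]
  · congr 2
    ext θ
    simp only [Set.mem_preimage, planeReflection, h1, h2, Set.mem_ofPred_eq, Real.cos_sub,
      Real.sin_sub]
  · intro θ
    simp

/-- Since the uniform distribution on the circle is invariant under reflections, so is the law of
`R W`. -/
lemma radialLaw_map_planeReflection (ν : Measure ℝ) [IsProbabilityMeasure ν] {c : ℝ × ℝ}
    (hc : planeDot c c = 1) : (radialLaw ν).map (planeReflection c) = radialLaw ν := by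
  have hm : Measurable fun p : ℝ × ℝ × ℝ => (p.1 * p.2.1, p.1 * p.2.2) := by fun_prop
  have h : ν.prod circleUniform =
      (ν.prod circleUniform).map (Prod.map id (planeReflection c)) := by
    rw [← Measure.map_prod_map _ _ measurable_id (measurable_planeReflection c), Measure.map_id,
      circleUniform_map_planeReflection hc]
  conv_rhs => rw [radialLaw, h]
  rw [radialLaw, Measure.map_map (measurable_planeReflection c) hm,
    Measure.map_map hm (measurable_id.prodMap (measurable_planeReflection c))]
  congr 1
  ext p
  · simp only [Function.comp, planeReflection, Prod.map, id]; ring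
  · simp only [Function.comp, planeReflection, Prod.map, id]; ring

lemma radialLaw_real_preimage (ν : Measure ℝ) [IsProbabilityMeasure ν] {c : ℝ × ℝ}
    (hc : planeDot c c = 1) {s : Set (ℝ × ℝ)} (hs : MeasurableSet s) :
    (radialLaw ν).real (planeReflection c ⁻¹' s) = (radialLaw ν).real s := by
  conv_rhs => rw [← radialLaw_map_planeReflection ν hc]
  rw [map_measureReal_apply (measurable_planeReflection c) hs]

/-! ### Monotonicity of the joint distribution function in the dependence parameter -/

/-- The joint distribution function of the projections `⟨u, R W⟩` and `⟨v, R W⟩` of the radial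
vector `R W`. -/
noncomputable def projCdf (ν : Measure ℝ) (u v : ℝ × ℝ) (x y : ℝ) : ℝ :=
  (radialLaw ν).real {w | planeDot u w ≤ x ∧ planeDot v w ≤ y}

lemma measurableSet_planeDot_le (u v : ℝ × ℝ) (x y : ℝ) :
    MeasurableSet {w | planeDot u w ≤ x ∧ planeDot v w ≤ y} :=
  (measurableSet_le (measurable_planeDot u) measurable_const).inter
    (measurableSet_le (measurable_planeDot v) measurable_const)

/-- All projections of `R W` on unit vectors have the same law. -/
lemma radialLaw_map_planeDot (ν : Measure ℝ) [IsProbabilityMeasure ν] {u : ℝ × ℝ}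
    (hu : planeDot u u = 1) : (radialLaw ν).map (planeDot u) = (radialLaw ν).fst := by
  have he : planeDot ((1, 0) : ℝ × ℝ) (1, 0) = 1 := by simp [planeDot]
  conv_rhs => rw [Measure.fst, ← radialLaw_map_planeReflection ν (planeDot_swapParam he hu)]
  rw [Measure.map_map measurable_fst (measurable_planeReflection _)]
  congr 1
  ext w
  have h := planeDot_planeReflection (swapParam (1, 0) u) (1, 0) w
  rw [planeReflection_swapParam_left he] at h
  simp only [Function.comp, ← h]
  simp [planeDot]

lemma projCdf_planeReflection (ν : Measure ℝ) [IsProbabilityMeasure ν] {c : ℝ × ℝ}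
    (hc : planeDot c c = 1) (u v : ℝ × ℝ) (x y : ℝ) :
    projCdf ν (planeReflection c u) (planeReflection c v) x y = projCdf ν u v x y := by
  rw [projCdf, projCdf, ← radialLaw_real_preimage ν hc (measurableSet_planeDot_le u v x y)]
  simp only [Set.preimage_ofPred_eq, planeDot_planeReflection]

/-- The reflection that exchanges `v` and `v'` moves every `w` parallel to `v' - v`; hence
it decreases `⟨u, ·⟩` exactly where it decreases `⟨v', ·⟩`, provided that `⟨u, v⟩ ≤ ⟨u, v'⟩`. -/
lemma planeDot_swap_mul_nonneg {u v v' : ℝ × ℝ} (hv : planeDot v v = 1)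
    (hv' : planeDot v' v' = 1) (h : planeDot u v ≤ planeDot u v') (w : ℝ × ℝ) :
    0 ≤ (planeDot u w - planeDot u (planeReflection (swapParam v v') w)) *
      (planeDot v' w - planeDot v w) := by
  by_cases hne : v = v'
  · simp [hne]
  have hpos : 0 < (v'.1 - v.1) ^ 2 + (v'.2 - v.2) ^ 2 := by
    by_contra hcon
    apply hne
    ext <;> nlinarith [sq_nonneg (v'.1 - v.1), sq_nonneg (v'.2 - v.2)]
  refine nonneg_of_mul_nonneg_right ?_ hpos
  have key : ((v'.1 - v.1) ^ 2 + (v'.2 - v.2) ^ 2) *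
      (planeDot u w - planeDot u (planeReflection (swapParam v v') w)) =
      2 * (planeDot u v' - planeDot u v) * (planeDot v' w - planeDot v w) := by
    simp only [planeDot, planeReflection, swapParam] at *
    grind
  rw [← mul_assoc, key, mul_assoc]
  have := mul_self_nonneg (planeDot v' w - planeDot v w)
  have := sub_nonneg.2 h
  positivity

lemma projCdf_le_of_same_left (ν : Measure ℝ) [IsProbabilityMeasure ν] {u v v' : ℝ × ℝ}
    (hv : planeDot v v = 1) (hv' : planeDot v' v' = 1) (h : planeDot u v ≤ planeDot u v')
    (x y : ℝ) : projCdf ν u v x y ≤ projCdf ν u v' x y := by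
  classical
  set c := swapParam v v'
  have hc : planeDot c c = 1 := planeDot_swapParam hv hv'
  have key : ∀ p : ℝ × ℝ, 2 * projCdf ν u p x y = ∫ w,
      ({w | planeDot u w ≤ x ∧ planeDot p w ≤ y}.indicator (1 : ℝ × ℝ → ℝ) w +
      (planeReflection c ⁻¹' {w | planeDot u w ≤ x ∧ planeDot p w ≤ y}).indicator
        (1 : ℝ × ℝ → ℝ) w) ∂(radialLaw ν) := by
    intro p
    have hm := measurableSet_planeDot_le u p x y
    have hm' := measurable_planeReflection c hm
    rw [integral_add ((integrable_const 1).indicator hm) ((integrable_const 1).indicator hm'),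
      integral_indicator_one hm, integral_indicator_one hm', radialLaw_real_preimage ν hc hm,
      projCdf]
    ring
  have hint : ∀ p : ℝ × ℝ, Integrable (fun w =>
      {w | planeDot u w ≤ x ∧ planeDot p w ≤ y}.indicator (1 : ℝ × ℝ → ℝ) w +
      (planeReflection c ⁻¹' {w | planeDot u w ≤ x ∧ planeDot p w ≤ y}).indicator
        (1 : ℝ × ℝ → ℝ) w) (radialLaw ν) := by
    intro p
    have hm := measurableSet_planeDot_le u p x y
    exact ((integrable_const 1).indicator hm).add
      ((integrable_const 1).indicator (measurable_planeReflection c hm))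
  suffices 2 * projCdf ν u v x y ≤ 2 * projCdf ν u v' x y by linarith
  rw [key, key]
  refine integral_mono (hint v) (hint v') fun w => ?_
  have h1 := planeDot_swap_mul_nonneg hv hv' h w
  have h2 : planeDot v (planeReflection c w) = planeDot v' w := by
    rw [planeDot_planeReflection, planeReflection_swapParam_left hv]
  have h3 : planeDot v' (planeReflection c w) = planeDot v w := by
    rw [planeDot_planeReflection, planeReflection_swapParam_right hv']
  simp only [Set.indicator_apply, Set.mem_preimage, Set.mem_ofPred_eq, Pi.one_apply, h2, h3]
  change 0 ≤ (planeDot u w - planeDot u (planeReflection c w)) * _ at h1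
  generalize planeDot u w = a at *
  generalize planeDot u (planeReflection c w) = b at *
  generalize planeDot v w = p at *
  generalize planeDot v' w = p' at *
  rcases mul_nonneg_iff.1 h1 with ⟨ha, hp⟩ | ⟨ha, hp⟩ <;> split_ifs <;> grind

/-- For projections on unit vectors, the joint distribution function is increasing in the inner
product of the two vectors. -/
lemma projCdf_le (ν : Measure ℝ) [IsProbabilityMeasure ν] {u v u' v' : ℝ × ℝ}
    (hu : planeDot u u = 1) (hv : planeDot v v = 1) (hu' : planeDot u' u' = 1)
    (hv' : planeDot v' v' = 1) (h : planeDot u v ≤ planeDot u' v') (x y : ℝ) :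
    projCdf ν u v x y ≤ projCdf ν u' v' x y := by
  have hc := planeDot_swapParam hu hu'
  rw [← projCdf_planeReflection ν hc u v, planeReflection_swapParam_left hu]
  refine projCdf_le_of_same_left ν ?_ hv' ?_ x y
  · rw [planeDot_planeReflection_self hc, hv]
  · refine le_trans (le_of_eq ?_) h
    rw [← planeDot_planeReflection_self hc u v, planeReflection_swapParam_left hu]

/-! ### Elliptical laws in terms of projections of the radial vector -/

/-- The common distribution function of all projections of `R W` on unit vectors. -/
noncomputable def radialCdf (ν : Measure ℝ) (t : ℝ) : ℝ := cdf (radialLaw ν).fst t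

lemma measure_singleton_of_continuous_cdf {τ : Measure ℝ} [IsProbabilityMeasure τ]
    (h : Continuous (cdf τ)) (x : ℝ) : τ {x} = 0 := by
  rw [← measure_cdf τ, StieltjesFunction.measure_singleton,
    h.continuousAt.continuousWithinAt.leftLim_eq, sub_self, ENNReal.ofReal_zero]

lemma radialLaw_real_planeDot_le (ν : Measure ℝ) [IsProbabilityMeasure ν] {u : ℝ × ℝ}
    (hu : planeDot u u = 1) (t : ℝ) :
    (radialLaw ν).real {w | planeDot u w ≤ t} = radialCdf ν t := by
  rw [radialCdf, cdf_eq_real, ← radialLaw_map_planeDot ν hu,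
    map_measureReal_apply (measurable_planeDot u) measurableSet_Iic]
  rfl

lemma ellipticalLaw_eq_map_radialLaw (m : ℝ × ℝ) (A : Matrix (Fin 2) (Fin 2) ℝ) (ν : Measure ℝ) :
    ellipticalLaw m A ν = (radialLaw ν).map fun w =>
      (m.1 + planeDot (A 0 0, A 0 1) w, m.2 + planeDot (A 1 0, A 1 1) w) := by
  rw [radialLaw, Measure.map_map (by unfold planeDot; fun_prop) (by fun_prop), ellipticalLaw]
  congr 1
  ext p <;> simp only [Function.comp, planeDot] <;> ring

lemma planeDot_rows_of_mul_transpose {A : Matrix (Fin 2) (Fin 2) ℝ} {σX σY ρ : ℝ} :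
    A * A.transpose = ellipticityMatrix σX σY ρ →
      planeDot (A 0 0, A 0 1) (A 0 0, A 0 1) = σX ^ 2 ∧
      planeDot (A 0 0, A 0 1) (A 1 0, A 1 1) = σX * σY * ρ ∧
      planeDot (A 1 0, A 1 1) (A 1 0, A 1 1) = σY ^ 2 := by
  intro h
  have h00 := congrFun (congrFun h 0) 0
  have h01 := congrFun (congrFun h 0) 1
  have h11 := congrFun (congrFun h 1) 1
  simp [Matrix.mul_apply, Fin.sum_univ_two, ellipticityMatrix] at h00 h01 h11
  exact ⟨h00, h01, h11⟩

section Elliptical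

variable {κ : Measure (ℝ × ℝ)} {μX μY σX σY ρ : ℝ} {ν : Measure ℝ}

lemma planeDot_eq_zero_of_self {a : ℝ × ℝ} (h : planeDot a a = 0) (w : ℝ × ℝ) :
    planeDot a w = 0 := by
  simp only [planeDot] at *
  have h1 : a.1 = 0 := by nlinarith [mul_self_nonneg a.1, mul_self_nonneg a.2]
  have h2 : a.2 = 0 := by nlinarith [mul_self_nonneg a.1, mul_self_nonneg a.2]
  simp [h1, h2]

lemma IsElliptical.isProbabilityMeasure [IsProbabilityMeasure ν]
    (h : IsElliptical κ μX μY σX σY ρ ν) : IsProbabilityMeasure κ := by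
  obtain ⟨-, -, A, -, rfl⟩ := h
  exact Measure.isProbabilityMeasure_map (by fun_prop)

lemma IsElliptical.snd_eq_dirac [IsProbabilityMeasure ν] (h : IsElliptical κ μX μY σX 0 ρ ν) :
    κ.snd = Measure.dirac μY := by
  obtain ⟨-, -, A, hA, rfl⟩ := h
  have h2 := (planeDot_rows_of_mul_transpose hA).2.2
  rw [ellipticalLaw_eq_map_radialLaw, Measure.snd,
    Measure.map_map measurable_snd (by unfold planeDot; fun_prop)]
  simp [Function.comp_def, planeDot_eq_zero_of_self (by simpa using h2)]

lemma IsElliptical.fst_eq_dirac [IsProbabilityMeasure ν] (h : IsElliptical κ μX μY 0 σY ρ ν) :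
    κ.fst = Measure.dirac μX := by
  obtain ⟨-, -, A, hA, rfl⟩ := h
  have h2 := (planeDot_rows_of_mul_transpose hA).1
  rw [ellipticalLaw_eq_map_radialLaw, Measure.fst,
    Measure.map_map measurable_fst (by unfold planeDot; fun_prop)]
  simp [Function.comp_def, planeDot_eq_zero_of_self (by simpa using h2)]

lemma IsElliptical.fst_scale_pos [IsProbabilityMeasure ν] (h : IsElliptical κ μX μY σX σY ρ ν)
    (hc : Continuous (cdf κ.fst)) : 0 < σX := by
  refine lt_of_le_of_ne h.1 fun h0 => ?_
  subst h0
  have := h.isProbabilityMeasure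
  have h1 := measure_singleton_of_continuous_cdf hc μX
  rw [h.fst_eq_dirac] at h1
  simp at h1

lemma IsElliptical.snd_scale_pos [IsProbabilityMeasure ν] (h : IsElliptical κ μX μY σX σY ρ ν)
    (hc : Continuous (cdf κ.snd)) : 0 < σY := by
  refine lt_of_le_of_ne h.2.1 fun h0 => ?_
  subst h0
  have := h.isProbabilityMeasure
  have h1 := measure_singleton_of_continuous_cdf hc μY
  rw [h.snd_eq_dirac] at h1
  simp at h1

lemma planeDot_div_self {a : ℝ × ℝ} {σ : ℝ} (hσ : 0 < σ) (h : planeDot a a = σ ^ 2) :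
    planeDot (a.1 / σ, a.2 / σ) (a.1 / σ, a.2 / σ) = 1 := by
  simp only [planeDot] at *
  field_simp
  linarith

lemma planeDot_eq_mul_div {a : ℝ × ℝ} {σ : ℝ} (hσ : 0 < σ) (w : ℝ × ℝ) :
    planeDot a w = σ * planeDot (a.1 / σ, a.2 / σ) w := by
  simp only [planeDot]
  field_simp

lemma IsElliptical.cdf_fst [IsProbabilityMeasure ν] (h : IsElliptical κ μX μY σX σY ρ ν)
    (hX : 0 < σX) (x : ℝ) : cdf κ.fst (μX + σX * x) = radialCdf ν x := by
  have hκ := h.isProbabilityMeasure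
  obtain ⟨-, -, A, hA, hlaw⟩ := h
  obtain ⟨h1, -, -⟩ := planeDot_rows_of_mul_transpose hA
  have hm := measurable_planeDot (A 0 0, A 0 1)
  have hm' := measurable_planeDot (A 1 0, A 1 1)
  rw [ellipticalLaw_eq_map_radialLaw] at hlaw
  rw [cdf_eq_real, hlaw, Measure.fst, Measure.map_map measurable_fst (by fun_prop),
    map_measureReal_apply (by fun_prop) measurableSet_Iic,
    ← radialLaw_real_planeDot_le ν (planeDot_div_self hX h1)]
  congr 1
  ext w
  simp [planeDot_eq_mul_div (a := (A 0 0, A 0 1)) hX, hX]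

lemma IsElliptical.cdf_snd [IsProbabilityMeasure ν] (h : IsElliptical κ μX μY σX σY ρ ν)
    (hY : 0 < σY) (y : ℝ) : cdf κ.snd (μY + σY * y) = radialCdf ν y := by
  have hκ := h.isProbabilityMeasure
  obtain ⟨-, -, A, hA, hlaw⟩ := h
  obtain ⟨-, -, h3⟩ := planeDot_rows_of_mul_transpose hA
  have hm := measurable_planeDot (A 0 0, A 0 1)
  have hm' := measurable_planeDot (A 1 0, A 1 1)
  rw [ellipticalLaw_eq_map_radialLaw] at hlaw
  rw [cdf_eq_real, hlaw, Measure.snd, Measure.map_map measurable_snd (by fun_prop),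
    map_measureReal_apply (by fun_prop) measurableSet_Iic,
    ← radialLaw_real_planeDot_le ν (planeDot_div_self hY h3)]
  congr 1
  ext w
  simp [planeDot_eq_mul_div (a := (A 1 0, A 1 1)) hY, hY]

/-- After standardization, the components of an elliptical vector with positive scales are
projections of the radial vector on two unit vectors whose inner product is the dependence
parameter. -/
lemma IsElliptical.exists_projCdf [IsProbabilityMeasure ν] (h : IsElliptical κ μX μY σX σY ρ ν)
    (hX : 0 < σX) (hY : 0 < σY) :
    ∃ u v : ℝ × ℝ, planeDot u u = 1 ∧ planeDot v v = 1 ∧ planeDot u v = ρ ∧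
      ∀ x y, κ.real (Set.Iic (μX + σX * x) ×ˢ Set.Iic (μY + σY * y)) = projCdf ν u v x y := by
  obtain ⟨-, -, A, hA, hlaw⟩ := h
  obtain ⟨h1, h2, h3⟩ := planeDot_rows_of_mul_transpose hA
  have hm := measurable_planeDot (A 0 0, A 0 1)
  have hm' := measurable_planeDot (A 1 0, A 1 1)
  rw [ellipticalLaw_eq_map_radialLaw] at hlaw
  refine ⟨_, _, planeDot_div_self hX h1, planeDot_div_self hY h3, ?_, fun x y => ?_⟩
  · simp only [planeDot] at *
    field_simp
    linarith
  · rw [hlaw, map_measureReal_apply (by fun_prop) (measurableSet_Iic.prod measurableSet_Iic),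
      projCdf]
    congr 1
    ext w
    simp [planeDot_eq_mul_div (a := (A 0 0, A 0 1)) hX,
      planeDot_eq_mul_div (a := (A 1 0, A 1 1)) hY, hX, hY]

lemma IsElliptical.continuous_radialCdf [IsProbabilityMeasure ν]
    (h : IsElliptical κ μX μY σX σY ρ ν) (hc : Continuous (cdf κ.fst)) :
    Continuous (radialCdf ν) := by
  have h1 : radialCdf ν = fun x => cdf κ.fst (μX + σX * x) :=
    funext fun x => (h.cdf_fst (h.fst_scale_pos hc) x).symm
  rw [h1]
  fun_prop

end Elliptical

lemma radialLaw_real_planeDot_eq (ν : Measure ℝ) [IsProbabilityMeasure ν]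
    (hF : Continuous (radialCdf ν)) {u : ℝ × ℝ} (hu : planeDot u u = 1) (t : ℝ) :
    (radialLaw ν).real {w | planeDot u w = t} = 0 := by
  have h := measure_singleton_of_continuous_cdf (τ := (radialLaw ν).fst) hF t
  rw [← radialLaw_map_planeDot ν hu, Measure.map_apply (measurable_planeDot u) (by simp)] at h
  rw [measureReal_def]
  exact (ENNReal.toReal_eq_zero_iff _).2 (Or.inl h)

/-- By symmetry of the radial vector, `0` is a median of its projections. -/
lemma radialCdf_zero (ν : Measure ℝ) [IsProbabilityMeasure ν] (hF : Continuous (radialCdf ν)) :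
    radialCdf ν 0 = 1 / 2 := by
  have hu : planeDot ((1, 0) : ℝ × ℝ) (1, 0) = 1 := by simp [planeDot]
  have hu' : planeDot ((-1, 0) : ℝ × ℝ) (-1, 0) = 1 := by simp [planeDot]
  have h1 := radialLaw_real_planeDot_le ν hu 0
  have h2 := radialLaw_real_planeDot_le ν hu' 0
  have h3 := radialLaw_real_planeDot_eq ν hF hu 0
  have h4 := measureReal_union_add_inter (μ := radialLaw ν)
    (s := {w | planeDot ((1, 0) : ℝ × ℝ) w ≤ 0}) (t := {w | planeDot ((-1, 0) : ℝ × ℝ) w ≤ 0})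
    (measurableSet_le (measurable_planeDot _) measurable_const)
  have h5 : {w | planeDot ((1, 0) : ℝ × ℝ) w ≤ 0} ∪ {w | planeDot ((-1, 0) : ℝ × ℝ) w ≤ 0} =
      Set.univ := by
    ext w
    simpa [planeDot] using le_total w.1 0
  have h6 : {w | planeDot ((1, 0) : ℝ × ℝ) w ≤ 0} ∩ {w | planeDot ((-1, 0) : ℝ × ℝ) w ≤ 0} =
      {w | planeDot ((1, 0) : ℝ × ℝ) w = 0} := by
    ext w
    simpa [planeDot] using (le_antisymm_iff).symm
  rw [h5, h6, h1, h2, h3, probReal_univ] at h4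
  linarith

/-! ### Strict monotonicity of the conditional distribution function at the median -/

/-- On an arc symmetric about the angle `0` that carries (almost) no angle at which the sinusoid
`r * (a * cos θ + b * sin θ)` lies in `(z, 0]`, the sinusoid has the sign that it has at `0`. -/
lemma sinusoid_sign_of_null {r a b q z : ℝ} (hr : 0 ≤ r) (hz : z < 0)
    (h0 : volume (Set.Ioc (-Real.pi) Real.pi ∩ {θ | q < r * Real.cos θ ∧
      z < r * (a * Real.cos θ + b * Real.sin θ) ∧
      r * (a * Real.cos θ + b * Real.sin θ) ≤ 0}) = 0)
    {θ : ℝ} (hθ : θ ∈ Set.Ioc (-Real.pi) Real.pi) (hq : q < r * Real.cos θ) :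
    (0 ≤ a → 0 ≤ r * (a * Real.cos θ + b * Real.sin θ)) ∧
      (a < 0 → r * (a * Real.cos θ + b * Real.sin θ) ≤ 0) := by
  set f : ℝ → ℝ := fun t => r * (a * Real.cos t + b * Real.sin t) with hf
  have hfc : Continuous f := by fun_prop
  have hf0 : f 0 = r * a := by simp [hf]
  have habs : ∀ t ∈ Set.uIcc 0 θ, |t| ≤ |θ| ∧ t ∈ Set.Ioc (-Real.pi) Real.pi := by
    intro t ht
    rcases le_total 0 θ with h | h
    · rw [Set.uIcc_of_le h] at ht
      exact ⟨abs_le_abs_of_nonneg ht.1 ht.2, by linarith [hθ.1, ht.1, Real.pi_pos],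
        ht.2.trans hθ.2⟩
    · rw [Set.uIcc_of_ge h] at ht
      exact ⟨abs_le_abs_of_nonpos ht.2 ht.1, by linarith [hθ.1, ht.1],
        by linarith [ht.2, Real.pi_pos]⟩
  have hθabs : |θ| ≤ Real.pi := abs_le.2 ⟨hθ.1.le, hθ.2⟩
  -- Between a negative and a nonnegative value the sinusoid takes values in `(z, 0)`, and it does
  -- so on an open set of angles.
  have main : ∀ t₀ ∈ Set.uIcc 0 θ, ∀ t₁ ∈ Set.uIcc 0 θ, f t₀ < 0 → 0 ≤ f t₁ → False := by
    intro t₀ ht₀ t₁ ht₁ h₀ h₁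
    have hmem : max z (f t₀) / 2 ∈ Set.Icc (f t₀) (f t₁) :=
      ⟨by linarith [le_max_right z (f t₀)], by linarith [max_lt hz h₀]⟩
    obtain ⟨t, ht, hft⟩ :=
      isPreconnected_uIcc.intermediate_value ht₀ ht₁ hfc.continuousOn hmem
    have htq : q < r * Real.cos t := by
      refine hq.trans_le (mul_le_mul_of_nonneg_left ?_ hr)
      rw [← Real.cos_abs t, ← Real.cos_abs θ]
      exact Real.cos_le_cos_of_nonneg_of_le_pi (abs_nonneg t) hθabs (habs t ht).1
    have hopen : IsOpen {s | q < r * Real.cos s ∧ z < f s ∧ f s < 0} :=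
      (isOpen_lt continuous_const (g := fun s => r * Real.cos s) (by fun_prop)).inter
        ((isOpen_lt continuous_const hfc).inter (isOpen_lt hfc continuous_const))
    have htmem : t ∈ {s | q < r * Real.cos s ∧ z < f s ∧ f s < 0} :=
      ⟨htq, by rw [hft]; linarith [le_max_left z (f t₀), max_lt hz h₀],
        by rw [hft]; linarith [max_lt hz h₀]⟩
    have hcl : t ∈ closure (Set.Ioo (-Real.pi) Real.pi) := by
      rw [closure_Ioo (by linarith [Real.pi_pos])]
      exact Set.Ioc_subset_Icc_self (habs t ht).2
    have hne := mem_closure_iff.1 hcl _ hopen htmem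
    refine (hopen.inter isOpen_Ioo).measure_ne_zero volume hne (measure_mono_null ?_ h0)
    rintro s ⟨⟨hs1, hs2, hs3⟩, hs⟩
    exact ⟨Set.Ioo_subset_Ioc_self hs, hs1, hs2, hs3.le⟩
  constructor
  · intro ha
    by_contra hcon
    exact main θ Set.right_mem_uIcc 0 Set.left_mem_uIcc (not_le.1 hcon)
      (by rw [hf0]; positivity)
  · intro ha
    by_contra hcon
    have hpos : 0 < f θ := not_le.1 hcon
    have hr0 : 0 < r := by
      refine lt_of_le_of_ne hr fun h => ?_
      simp [hf, ← h] at hpos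
    exact main 0 Set.left_mem_uIcc θ Set.right_mem_uIcc
      (by rw [hf0]; exact mul_neg_of_pos_of_neg hr0 ha) hpos.le

lemma radialLaw_null_iff (ν : Measure ℝ) [IsProbabilityMeasure ν] {S : Set (ℝ × ℝ)}
    (hS : MeasurableSet S) :
    radialLaw ν S = 0 ↔ ∀ᵐ r ∂ν, volume (Set.Ioc (-Real.pi) Real.pi ∩
      {θ | (r * Real.cos θ, r * Real.sin θ) ∈ S}) = 0 := by
  have hm : Measurable fun p : ℝ × ℝ × ℝ => (p.1 * p.2.1, p.1 * p.2.2) := by fun_prop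
  rw [radialLaw, Measure.map_apply hm hS, Measure.measure_prod_null (hm hS)]
  refine Filter.eventually_congr (Filter.Eventually.of_forall fun r => ?_)
  have hm1 : Measurable fun θ : ℝ => (Real.cos θ, Real.sin θ) := by fun_prop
  have hm2 : MeasurableSet (Prod.mk r ⁻¹'
      ((fun p : ℝ × ℝ × ℝ => (p.1 * p.2.1, p.1 * p.2.2)) ⁻¹' S)) :=
    measurable_prodMk_left (hm hS)
  beta_reduce
  rw [circleUniform, Measure.map_apply hm1 hm2, cond_apply measurableSet_Ioc]
  simp only [Pi.zero_apply, mul_eq_zero, ENNReal.inv_eq_zero]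
  have : volume (Set.Ioc (-Real.pi) Real.pi) ≠ ⊤ := by simp
  simp only [this, false_or]
  rfl

lemma radialCdf_sub_projCdf (ν : Measure ℝ) [IsProbabilityMeasure ν] (u : ℝ × ℝ) {v : ℝ × ℝ}
    (hv : planeDot v v = 1) (q y : ℝ) :
    radialCdf ν y - projCdf ν u v q y =
      (radialLaw ν).real {w | q < planeDot u w ∧ planeDot v w ≤ y} := by
  rw [← radialLaw_real_planeDot_le ν hv, projCdf,
    ← measureReal_sdiff _ (measurableSet_planeDot_le u v q y)]
  · congr 1
    ext w
    simp only [Set.mem_sdiff, Set.mem_ofPred_eq]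
    grind
  · exact fun w hw => hw.2

/-- Given that one projection of `R W` exceeds `q`, the conditional distribution function of the
other one strictly increases on `[z, 0]` for `z < 0`, unless it is `0` or `1` at the median `0`. -/
lemma eq_zero_or_eq_of_flat (ν : Measure ℝ) [IsProbabilityMeasure ν] (hν : ν (Set.Iio 0) = 0)
    (hF : Continuous (radialCdf ν)) {u v : ℝ × ℝ} (hu : planeDot u u = 1) (hv : planeDot v v = 1)
    {q z : ℝ} (hz : z < 0)
    (h : radialCdf ν 0 - projCdf ν u v q 0 ≤ radialCdf ν z - projCdf ν u v q z) :
    radialCdf ν 0 - projCdf ν u v q 0 = 0 ∨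
      radialCdf ν 0 - projCdf ν u v q 0 = 1 - radialCdf ν q := by
  wlog hue : u = (1, 0) generalizing u v
  · have he : planeDot ((1, 0) : ℝ × ℝ) (1, 0) = 1 := by simp [planeDot]
    have hc := planeDot_swapParam hu he
    have hcu := planeReflection_swapParam_left (v' := (1, 0)) hu
    simp only [← projCdf_planeReflection ν hc u v, hcu] at h ⊢
    exact this he (by rw [planeDot_planeReflection_self hc, hv]) h rfl
  subst hue
  simp only [radialCdf_sub_projCdf ν _ hv] at h ⊢
  have hmU := measurable_planeDot (1, 0)
  have hmV := measurable_planeDot v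
  have hnull : radialLaw ν {w | q < planeDot (1, 0) w ∧ z < planeDot v w ∧ planeDot v w ≤ 0} = 0
      := by
    have hd := measureReal_sdiff (μ := radialLaw ν)
      (s₁ := {w | q < planeDot (1, 0) w ∧ planeDot v w ≤ 0})
      (s₂ := {w | q < planeDot (1, 0) w ∧ planeDot v w ≤ z})
      (fun w hw => ⟨hw.1, hw.2.trans hz.le⟩)
      ((measurableSet_lt measurable_const hmU).inter (measurableSet_le hmV measurable_const))
    have hset : {w | q < planeDot (1, 0) w ∧ planeDot v w ≤ 0} \
        {w | q < planeDot (1, 0) w ∧ planeDot v w ≤ z} =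
        {w | q < planeDot (1, 0) w ∧ z < planeDot v w ∧ planeDot v w ≤ 0} := by
      ext w
      simp only [Set.mem_sdiff, Set.mem_ofPred_eq]
      grind
    rw [hset] at hd
    rw [← measureReal_eq_zero_iff]
    exact le_antisymm (by linarith) measureReal_nonneg
  have hS : MeasurableSet
      {w : ℝ × ℝ | q < planeDot (1, 0) w ∧ z < planeDot v w ∧ planeDot v w ≤ 0} :=
    (measurableSet_lt measurable_const hmU).inter
      ((measurableSet_lt measurable_const hmV).inter (measurableSet_le hmV measurable_const))
  have hr : ∀ᵐ r ∂ν, 0 ≤ r := by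
    rw [ae_iff]
    simpa [Set.Iio] using hν
  have hdot : ∀ r θ : ℝ, planeDot v (r * Real.cos θ, r * Real.sin θ) =
      r * (v.1 * Real.cos θ + v.2 * Real.sin θ) := fun r θ => by simp only [planeDot]; ring
  have hdot' : ∀ r θ : ℝ, planeDot (1, 0) (r * Real.cos θ, r * Real.sin θ) = r * Real.cos θ :=
    fun r θ => by simp [planeDot]
  have hae := (radialLaw_null_iff ν hS).1 hnull
  simp only [Set.mem_ofPred_eq, hdot, hdot'] at hae
  rcases le_or_gt 0 v.1 with h1 | h1
  · left
    have hneg : radialLaw ν {w | q < planeDot (1, 0) w ∧ planeDot v w < 0} = 0 := by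
      have hm : MeasurableSet {w | q < planeDot (1, 0) w ∧ planeDot v w < 0} :=
        (measurableSet_lt measurable_const hmU).inter (measurableSet_lt hmV measurable_const)
      rw [radialLaw_null_iff ν hm]
      filter_upwards [hr, hae] with r hr0 hr1
      convert measure_empty (μ := (volume : Measure ℝ))
      ext θ
      simp only [Set.mem_inter_iff, Set.mem_ofPred_eq, hdot, hdot', Set.mem_empty_iff_false,
        iff_false]
      rintro ⟨hθ, hq, hlt⟩
      exact absurd ((sinusoid_sign_of_null hr0 hz hr1 hθ hq).1 h1) (not_le.2 hlt)
    rw [measureReal_eq_zero_iff]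
    have h0 := radialLaw_real_planeDot_eq ν hF hv 0
    rw [measureReal_eq_zero_iff] at h0
    refine measure_mono_null (fun w hw => ?_) (measure_union_null hneg h0)
    rcases lt_or_eq_of_le hw.2 with h2 | h2
    · exact Or.inl ⟨hw.1, h2⟩
    · exact Or.inr h2
  · right
    have hpos : radialLaw ν {w | q < planeDot (1, 0) w ∧ 0 < planeDot v w} = 0 := by
      have hm : MeasurableSet {w | q < planeDot (1, 0) w ∧ 0 < planeDot v w} :=
        (measurableSet_lt measurable_const hmU).inter (measurableSet_lt measurable_const hmV)
      rw [radialLaw_null_iff ν hm]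
      filter_upwards [hr, hae] with r hr0 hr1
      convert measure_empty (μ := (volume : Measure ℝ))
      ext θ
      simp only [Set.mem_inter_iff, Set.mem_ofPred_eq, hdot, hdot', Set.mem_empty_iff_false,
        iff_false]
      rintro ⟨hθ, hq, hlt⟩
      exact absurd ((sinusoid_sign_of_null hr0 hz hr1 hθ hq).2 h1) (not_le.2 hlt)
    have hcompl : (radialLaw ν).real {w | q < planeDot (1, 0) w} = 1 - radialCdf ν q := by
      rw [← radialLaw_real_planeDot_le ν hu, ← probReal_compl_eq_one_sub
        (measurableSet_le hmU measurable_const)]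
      congr 1
      ext w
      simp
    rw [← hcompl]
    refine measureReal_congr (Filter.eventuallyEq_set.2 ?_)
    have hpos' := measure_eq_zero_iff_ae_notMem.1 hpos
    filter_upwards [hpos'] with w hw
    simp only [not_and, not_lt] at hw ⊢
    exact ⟨fun h => h.1, fun h => ⟨h, hw h⟩⟩

/-! ### Quantiles and conditional quantiles -/

lemma exists_cdf_eq {τ : Measure ℝ} (h : Continuous (cdf τ)) {α : ℝ}
    (hα : α ∈ Set.Ioo (0 : ℝ) 1) : ∃ x, cdf τ x = α :=
  mem_range_of_exists_le_of_exists_ge h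
    ((tendsto_cdf_atBot τ).eventually_le_const hα.1).exists
    ((tendsto_cdf_atTop τ).eventually_const_le hα.2).exists

lemma nonempty_setOf_le_cdf (τ : Measure ℝ) {β : ℝ} (hβ : β < 1) :
    {x | β ≤ cdf τ x}.Nonempty :=
  ((tendsto_cdf_atTop τ).eventually_const_le hβ).exists

lemma bddBelow_setOf_le_cdf (τ : Measure ℝ) {β : ℝ} (hβ : 0 < β) :
    BddBelow {x | β ≤ cdf τ x} := by
  obtain ⟨a, ha⟩ := ((tendsto_cdf_atBot τ).eventually_lt_const hβ).exists
  exact ⟨a, fun x hx => le_of_not_gt fun hlt =>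
    absurd (hx.trans (monotone_cdf τ hlt.le)) (not_le.2 ha)⟩

section CoVaR

variable {Ω Ω' : Type*} [MeasurableSpace Ω] [MeasurableSpace Ω'] {P : Measure Ω} {P' : Measure Ω'}
  {X Y : Ω → ℝ} {X' Y' : Ω' → ℝ} {α β : ℝ}

lemma VaR_le_of_cdf_eq (hα : 0 < α) {x : ℝ} (hx : cdf (P.map X) x = α) : VaR P X α ≤ x :=
  csInf_le (bddBelow_setOf_le_cdf _ hα) hx.ge

lemma cdf_VaR (hc : Continuous (cdf (P.map X))) (hα : α ∈ Set.Ioo (0 : ℝ) 1) :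
    cdf (P.map X) (VaR P X α) = α := by
  obtain ⟨x, hx⟩ := exists_cdf_eq hc hα
  refine le_antisymm ?_ ?_
  · rw [← hx]
    exact monotone_cdf _ (hx ▸ VaR_le_of_cdf_eq hα.1 hx)
  · exact (isClosed_le continuous_const hc).csInf_mem (nonempty_setOf_le_cdf _ hα.2)
      (bddBelow_setOf_le_cdf _ hα.1)

lemma VaR_le_VaR (hβ : β ∈ Set.Ioo (0 : ℝ) 1)
    (h : ∀ y', β ≤ cdf (P'.map Y') y' → ∃ y ≤ y', β ≤ cdf (P.map Y) y) :
    VaR P Y β ≤ VaR P' Y' β := by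
  refine le_csInf (nonempty_setOf_le_cdf _ hβ.2) fun y' hy' => ?_
  obtain ⟨y, hy, hb⟩ := h y' hy'
  exact (csInf_le (bddBelow_setOf_le_cdf _ hβ.1) hb).trans hy

/-- As `X` has no atoms, conditioning on `X ≥ VaR_α(X)` is the same as conditioning on `X > x` for
any `x` with `F_X(x) = α`. -/
lemma cdf_cond_VaR_le [IsProbabilityMeasure P] (hX : Measurable X) (hY : Measurable Y)
    (hc : Continuous (cdf (P.map X))) (hα : α ∈ Set.Ioo (0 : ℝ) 1) {x : ℝ}
    (hx : cdf (P.map X) x = α) (y : ℝ) :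
    cdf ((P[|{ω | VaR P X α ≤ X ω}]).map Y) y =
      (cdf (P.map Y) y - (P.map fun ω => (X ω, Y ω)).real (Set.Iic x ×ˢ Set.Iic y)) /
        (1 - α) := by
  have := Measure.isProbabilityMeasure_map hX.aemeasurable (μ := P)
  have := Measure.isProbabilityMeasure_map hY.aemeasurable (μ := P)
  have hle := VaR_le_of_cdf_eq hα.1 hx
  have hF : ∀ t, P.real {ω | X ω ≤ t} = cdf (P.map X) t := fun t => by
    rw [cdf_eq_real, map_measureReal_apply hX measurableSet_Iic]; rfl
  have hm : MeasurableSet {ω | VaR P X α ≤ X ω} := measurableSet_le measurable_const hX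
  have hmx : MeasurableSet {ω | X ω ≤ x} := measurableSet_le hX measurable_const
  have hmv : MeasurableSet {ω | X ω ≤ VaR P X α} := measurableSet_le hX measurable_const
  have hnull : P {ω | X ω = VaR P X α} = 0 := by
    have h := measure_singleton_of_continuous_cdf hc (VaR P X α)
    rwa [Measure.map_apply hX (measurableSet_singleton _)] at h
  have hsub : {ω | X ω ≤ VaR P X α} ⊆ {ω | X ω ≤ x} := fun ω hω => le_trans hω hle
  have hnull' : P ({ω | X ω ≤ x} \ {ω | X ω ≤ VaR P X α}) = 0 := by
    rw [← measureReal_eq_zero_iff, measureReal_sdiff hsub hmv, hF, hF, hx,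
      cdf_VaR hc hα, sub_self]
  have hae : {ω | VaR P X α ≤ X ω} =ᵐ[P] {ω | x < X ω} := by
    rw [Filter.eventuallyEq_set]
    filter_upwards [measure_eq_zero_iff_ae_notMem.1 hnull,
      measure_eq_zero_iff_ae_notMem.1 hnull'] with ω h1 h2
    simp only [Set.mem_sdiff, Set.mem_ofPred_eq] at h1 h2 ⊢
    grind
  have hden : P.real {ω | VaR P X α ≤ X ω} = 1 - α := by
    rw [measureReal_congr hae, ← hx, ← hF, ← probReal_compl_eq_one_sub hmx]
    congr 1
    ext ω
    simp
  have hpos : P {ω | VaR P X α ≤ X ω} ≠ 0 := by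
    intro h0
    rw [measureReal_def, h0] at hden
    have := hα.2
    simp at hden
    linarith
  have := cond_isProbabilityMeasure hpos
  have := Measure.isProbabilityMeasure_map hY.aemeasurable (μ := P[|{ω | VaR P X α ≤ X ω}])
  rw [cdf_eq_real, map_measureReal_apply hY measurableSet_Iic, measureReal_def, cond_apply hm,
    ENNReal.toReal_mul, ENNReal.toReal_inv, ← measureReal_def, ← measureReal_def, hden,
    inv_mul_eq_div]
  congr 1
  have hae' : ({ω | VaR P X α ≤ X ω} ∩ Y ⁻¹' Set.Iic y : Set Ω) =ᵐ[P]
      ({ω | x < X ω} ∩ Y ⁻¹' Set.Iic y : Set Ω) := hae.inter (Filter.EventuallyEq.refl _ _)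
  rw [measureReal_congr hae', cdf_eq_real,
    map_measureReal_apply hY measurableSet_Iic, map_measureReal_apply (hX.prodMk hY)
      (measurableSet_Iic.prod measurableSet_Iic), ← measureReal_sdiff]
  · congr 1
    ext ω
    simp only [Set.mem_inter_iff, Set.mem_ofPred_eq, Set.mem_sdiff, Set.mem_preimage, Set.mem_prod,
      Set.mem_Iic]
    grind
  · exact fun ω hω => hω.2
  · exact (hX.prodMk hY) (measurableSet_Iic.prod measurableSet_Iic)

/-- A comparison criterion for conditional quantiles in terms of the probabilities
`ℙ(X > x, Y ≤ y)`, where `F_X(x) = α`. -/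
lemma CoVaR_le_CoVaR [IsProbabilityMeasure P] [IsProbabilityMeasure P'] (hX : Measurable X)
    (hY : Measurable Y) (hX' : Measurable X') (hY' : Measurable Y')
    (hc : Continuous (cdf (P.map X))) (hc' : Continuous (cdf (P'.map X')))
    (hα : α ∈ Set.Ioo (0 : ℝ) 1) (hβ : β ∈ Set.Ioo (0 : ℝ) 1) {x x' : ℝ}
    (hx : cdf (P.map X) x = α) (hx' : cdf (P'.map X') x' = α)
    (h : ∀ y', β * (1 - α) ≤ cdf (P'.map Y') y' -
        (P'.map fun ω => (X' ω, Y' ω)).real (Set.Iic x' ×ˢ Set.Iic y') →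
      ∃ y ≤ y', β * (1 - α) ≤ cdf (P.map Y) y -
        (P.map fun ω => (X ω, Y ω)).real (Set.Iic x ×ˢ Set.Iic y)) :
    CoVaR P Y X α β ≤ CoVaR P' Y' X' α β := by
  refine VaR_le_VaR hβ fun y' hy' => ?_
  have h1 : 0 < 1 - α := sub_pos.2 hα.2
  rw [cdf_cond_VaR_le hX' hY' hc' hα hx', le_div_iff₀ h1] at hy'
  obtain ⟨y, hy, hb⟩ := h y' hy'
  refine ⟨y, hy, ?_⟩
  rwa [cdf_cond_VaR_le hX hY hc hα hx, le_div_iff₀ h1]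

end CoVaR

/-! ### Copulas -/

section Copula

variable {C : ℝ → ℝ → ℝ}

lemma real_Iic_of_unit_margin {τ : Measure ℝ}
    (h : τ = (volume : Measure ℝ).restrict (Set.Icc 0 1)) {v : ℝ} (hv : v ∈ Set.Icc (0 : ℝ) 1) :
    τ.real (Set.Iic v) = v := by
  rw [h, measureReal_restrict_apply measurableSet_Iic]
  have : Set.Iic v ∩ Set.Icc 0 1 = Set.Icc 0 v := by
    ext t
    have := hv.2
    simp only [Set.mem_inter_iff, Set.mem_Iic, Set.mem_Icc]
    grind
  rw [this, Real.volume_real_Icc, sub_zero, max_eq_left hv.1]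

/-- For a pair `(U, V)` with copula `C`, the probability `v - C(u, v)` of `U > u, V ≤ v` is
increasing in `v`. -/
lemma IsCopula.sub_le_sub (h : IsCopula C) {u v v' : ℝ} (hu : u ∈ Set.Icc (0 : ℝ) 1)
    (hv : v ∈ Set.Icc (0 : ℝ) 1) (hv' : v' ∈ Set.Icc (0 : ℝ) 1) (hle : v ≤ v') :
    v - C u v ≤ v' - C u v' := by
  obtain ⟨τ, hτ, -, h2, hC⟩ := h
  have key : ∀ t ∈ Set.Icc (0 : ℝ) 1, t - C u t = τ.real (Set.Ioi u ×ˢ Set.Iic t) := by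
    intro t ht
    have h3 := real_Iic_of_unit_margin h2 ht
    rw [Measure.snd, map_measureReal_apply measurable_snd measurableSet_Iic] at h3
    rw [hC u hu t ht]
    nth_rewrite 1 [← h3]
    rw [← measureReal_sdiff]
    · congr 1
      ext w
      simp only [Set.mem_sdiff, Set.mem_preimage, Set.mem_Iic, Set.mem_prod, Set.mem_Ioi]
      grind
    · exact fun w hw => hw.2
    · exact measurableSet_Iic.prod measurableSet_Iic
  rw [key v hv, key v' hv']
  exact measureReal_mono (Set.prod_mono le_rfl (Set.Iic_subset_Iic.2 hle))

lemma IsCopula.apply_zero (h : IsCopula C) {u : ℝ} (hu : u ∈ Set.Icc (0 : ℝ) 1) : C u 0 = 0 := by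
  obtain ⟨τ, hτ, -, h2, hC⟩ := h
  have h0 : (0 : ℝ) ∈ Set.Icc (0 : ℝ) 1 := by simp
  have h3 := real_Iic_of_unit_margin h2 h0
  rw [Measure.snd, map_measureReal_apply measurable_snd measurableSet_Iic] at h3
  rw [hC u hu 0 h0]
  exact le_antisymm ((measureReal_mono fun w hw => hw.2).trans h3.le) measureReal_nonneg

lemma IsCopula.apply_one (h : IsCopula C) {u : ℝ} (hu : u ∈ Set.Icc (0 : ℝ) 1) : C u 1 = u := by
  obtain ⟨τ, hτ, h1, h2, hC⟩ := h
  have h0 : (1 : ℝ) ∈ Set.Icc (0 : ℝ) 1 := by simp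
  have h3 := real_Iic_of_unit_margin h2 h0
  rw [Measure.snd, map_measureReal_apply measurable_snd measurableSet_Iic] at h3
  have h4 : ∀ᵐ w ∂τ, w ∈ Prod.snd ⁻¹' Set.Iic (1 : ℝ) := by
    refine (mem_ae_iff_prob_eq_one (measurable_snd measurableSet_Iic)).2 ?_
    rwa [measureReal_def, ENNReal.toReal_eq_one_iff] at h3
  rw [hC u hu 1 h0]
  conv_rhs => rw [← real_Iic_of_unit_margin h1 hu, Measure.fst,
    map_measureReal_apply measurable_fst measurableSet_Iic]
  refine measureReal_congr (Filter.eventuallyEq_set.2 ?_)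
  filter_upwards [h4] with w hw
  exact ⟨fun h => h.1, fun h => ⟨h, hw⟩⟩

/-- A copula of an elliptical law is determined by the radial law and the dependence parameter. -/
lemma IsCopulaOf.exists_projCdf {κ : Measure (ℝ × ℝ)} {μX μY σX σY ρ : ℝ} {ν : Measure ℝ}
    [IsProbabilityMeasure ν] (hC : IsCopulaOf C κ) (h : IsElliptical κ μX μY σX σY ρ ν)
    (hX : 0 < σX) (hY : 0 < σY) :
    ∃ u v : ℝ × ℝ, planeDot u u = 1 ∧ planeDot v v = 1 ∧ planeDot u v = ρ ∧
      ∀ x y, C (radialCdf ν x) (radialCdf ν y) = projCdf ν u v x y := by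
  obtain ⟨u, v, hu, hv, huv, hJ⟩ := h.exists_projCdf hX hY
  refine ⟨u, v, hu, hv, huv, fun x y => ?_⟩
  rw [← hJ, hC.2, h.cdf_fst hX, h.cdf_snd hY]

lemma IsEllipticalCopula.exists_projCdf {ρ : ℝ} {ν : Measure ℝ} [IsProbabilityMeasure ν]
    (hC : IsEllipticalCopula C ρ ν) : Continuous (radialCdf ν) ∧
    ∃ u v : ℝ × ℝ, planeDot u u = 1 ∧ planeDot v v = 1 ∧ planeDot u v = ρ ∧
      ∀ x y, C (radialCdf ν x) (radialCdf ν y) = projCdf ν u v x y := by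
  obtain ⟨κ, μX, μY, σX, σY, hκ, hc1, hc2, hCκ⟩ := hC
  exact ⟨hκ.continuous_radialCdf hc1,
    hCκ.exists_projCdf hκ (hκ.fst_scale_pos hc1) (hκ.snd_scale_pos hc2)⟩

/-- Elliptical copulas of the same type are pointwise increasing in the dependence parameter. -/
lemma IsEllipticalCopula.le {C' : ℝ → ℝ → ℝ} {ρ ρ' : ℝ} {ν : Measure ℝ} [IsProbabilityMeasure ν]
    (hC : IsEllipticalCopula C ρ ν) (hC' : IsEllipticalCopula C' ρ' ν) (hρ : ρ ≤ ρ') {α v : ℝ}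
    (hα : α ∈ Set.Ioo (0 : ℝ) 1) (hv : v ∈ Set.Icc (0 : ℝ) 1) : C α v ≤ C' α v := by
  have hαI := Set.Ioo_subset_Icc_self hα
  have h1 : IsCopula C := by obtain ⟨_, _, _, _, _, _, _, _, h⟩ := hC; exact h.1
  have h1' : IsCopula C' := by obtain ⟨_, _, _, _, _, _, _, _, h⟩ := hC'; exact h.1
  rcases eq_or_lt_of_le hv.1 with rfl | hv0
  · rw [h1.apply_zero hαI, h1'.apply_zero hαI]
  rcases eq_or_lt_of_le hv.2 with rfl | hv1
  · rw [h1.apply_one hαI, h1'.apply_one hαI]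
  obtain ⟨hF, u, w, hu, hw, huw, hJ⟩ := hC.exists_projCdf
  obtain ⟨-, u', w', hu', hw', huw', hJ'⟩ := hC'.exists_projCdf
  obtain ⟨q, rfl⟩ : ∃ q, radialCdf ν q = α := exists_cdf_eq hF hα
  obtain ⟨z, rfl⟩ : ∃ z, radialCdf ν z = v := exists_cdf_eq hF ⟨hv0, hv1⟩
  rw [hJ, hJ']
  exact projCdf_le ν hu hw hu' hw' (by rw [huw, huw']; exact hρ) q z

end Copula

/-! ### Comparison of the conditional quantiles -/

/-- If the level `β` is at least the conditional distribution function at the median for the smaller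
dependence parameter, then the standardized conditional `β`-quantile for the larger dependence
parameter is nonnegative. -/
lemma nonneg_of_median_level_le (ν : Measure ℝ) [IsProbabilityMeasure ν] (hν : ν (Set.Iio 0) = 0)
    (hF : Continuous (radialCdf ν)) {u v u' v' : ℝ × ℝ} (hu : planeDot u u = 1)
    (hv : planeDot v v = 1) (hu' : planeDot u' u' = 1) (hv' : planeDot v' v' = 1)
    (hle : planeDot u v ≤ planeDot u' v') {q β z : ℝ} (hq : radialCdf ν q < 1)
    (hβ : β ∈ Set.Ioo (0 : ℝ) 1)
    (hmed : (radialCdf ν 0 - projCdf ν u v q 0) / (1 - radialCdf ν q) ≤ β)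
    (hz : β * (1 - radialCdf ν q) ≤ radialCdf ν z - projCdf ν u' v' q z) : 0 ≤ z := by
  by_contra! hneg
  have h1 : 0 < 1 - radialCdf ν q := sub_pos.2 hq
  rw [div_le_iff₀ h1] at hmed
  have h2 := projCdf_le ν hu hv hu' hv' hle q z
  have h3 : radialCdf ν z - projCdf ν u v q z ≤ radialCdf ν 0 - projCdf ν u v q 0 := by
    rw [radialCdf_sub_projCdf ν u hv, radialCdf_sub_projCdf ν u hv]
    exact measureReal_mono fun w hw => ⟨hw.1, hw.2.trans hneg.le⟩
  have h4 : 0 < β * (1 - radialCdf ν q) := mul_pos hβ.1 h1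
  have h5 : β * (1 - radialCdf ν q) < 1 - radialCdf ν q := mul_lt_of_lt_one_left h1 hβ.2
  rcases eq_zero_or_eq_of_flat ν hν hF hu hv hneg (by linarith) with h6 | h6 <;> linarith

/-- If `Y` is almost surely equal to a constant `m`, then the conditional distribution function of
`Y` is `1` at `m`. -/
lemma one_sub_le_of_snd_eq_dirac {κ : Measure (ℝ × ℝ)} [IsProbabilityMeasure κ] {m x α : ℝ}
    (h : κ.snd = Measure.dirac m) (hx : cdf κ.fst x = α) :
    1 - α ≤ cdf κ.snd m - κ.real (Set.Iic x ×ˢ Set.Iic m) := by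
  have h1 : cdf κ.snd m = 1 := by
    rw [h, cdf_eq_real, measureReal_def, Measure.dirac_apply' _ measurableSet_Iic]
    simp
  have h2 : κ.real (Set.Iic x ×ˢ Set.Iic m) ≤ α := by
    rw [← hx, cdf_eq_real, Measure.fst, map_measureReal_apply measurable_fst measurableSet_Iic]
    exact measureReal_mono fun w hw => hw.1
  linarith

lemma le_of_cdf_dirac_pos {m y : ℝ} (h : 0 < cdf (Measure.dirac m) y) : m ≤ y := by
  by_contra hlt
  rw [cdf_eq_real, measureReal_def, Measure.dirac_apply' _ measurableSet_Iic] at h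
  simp [hlt] at h

theorem theorem4 {Ω Ω' : Type*} [MeasurableSpace Ω] [MeasurableSpace Ω']
    (P : Measure Ω) [IsProbabilityMeasure P] (P' : Measure Ω') [IsProbabilityMeasure P']
    (X Y : Ω → ℝ) (X' Y' : Ω' → ℝ)
    (hX : Measurable X) (hY : Measurable Y) (hX' : Measurable X') (hY' : Measurable Y')
    (hFX : Continuous (cdf (P.map X))) (hFX' : Continuous (cdf (P'.map X')))
    -- the law of the common nonnegative radial part
    (ν : Measure ℝ) [IsProbabilityMeasure ν] (hν : ν (Set.Iio 0) = 0)
    (ρ ρ' : ℝ) (hρ : ρ ≤ ρ') :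
    -- elliptical vectors with equal scales of `Y` and `Y'`
    (∀ μX μY σX σY μX' μY' σX' σY' : ℝ,
      IsElliptical (P.map fun ω => (X ω, Y ω)) μX μY σX σY ρ ν →
      IsElliptical (P'.map fun ω => (X' ω, Y' ω)) μX' μY' σX' σY' ρ' ν →
      μY ≤ μY' → σY = σY' →
      ∀ α ∈ Set.Ioo (0 : ℝ) 1, ∀ β ∈ Set.Ioo (0 : ℝ) 1,
        CoVaR P Y X α β ≤ CoVaR P' Y' X' α β) ∧
    -- elliptical vectors with ordered scales; `C` is the copula of `(X, Y)`, and if `Y` is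
    -- degenerate, so that this copula is not unique, then the elliptical one is meant
    (∀ μX μY σX σY μX' μY' σX' σY' : ℝ,
      IsElliptical (P.map fun ω => (X ω, Y ω)) μX μY σX σY ρ ν →
      IsElliptical (P'.map fun ω => (X' ω, Y' ω)) μX' μY' σX' σY' ρ' ν →
      μY ≤ μY' → σY ≤ σY' →
      ∀ C : ℝ → ℝ → ℝ, IsCopulaOf C (P.map fun ω => (X ω, Y ω)) →
        (σY = 0 → IsEllipticalCopula C ρ ν) →
      ∀ α ∈ Set.Ioo (0 : ℝ) 1, ∀ β ∈ Set.Ioo (0 : ℝ) 1,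
        (1 / 2 - C α (1 / 2)) / (1 - α) ≤ β →
        CoVaR P Y X α β ≤ CoVaR P' Y' X' α β) ∧
    -- elliptical copulas of the same type
    (∀ C C' : ℝ → ℝ → ℝ,
      IsCopulaOf C (P.map fun ω => (X ω, Y ω)) → IsEllipticalCopula C ρ ν →
      IsCopulaOf C' (P'.map fun ω => (X' ω, Y' ω)) → IsEllipticalCopula C' ρ' ν →
      (∀ y : ℝ, cdf (P'.map Y') y ≤ cdf (P.map Y) y) →
      ∀ α ∈ Set.Ioo (0 : ℝ) 1, ∀ β ∈ Set.Ioo (0 : ℝ) 1,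
        CoVaR P Y X α β ≤ CoVaR P' Y' X' α β) := by
  have hfst : (P.map fun ω => (X ω, Y ω)).fst = P.map X := Measure.fst_map_prodMk hY
  have hsnd : (P.map fun ω => (X ω, Y ω)).snd = P.map Y := Measure.snd_map_prodMk hX
  have hfst' : (P'.map fun ω => (X' ω, Y' ω)).fst = P'.map X' := Measure.fst_map_prodMk hY'
  have hsnd' : (P'.map fun ω => (X' ω, Y' ω)).snd = P'.map Y' := Measure.snd_map_prodMk hX'
  have hκ := Measure.isProbabilityMeasure_map (hX.prodMk hY).aemeasurable (μ := P)
  refine ⟨?_, ?_, ?_⟩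
  · intro μX μY σX σY μX' μY' σX' σY' hE hE' hμ hσ α hα β hβ
    subst hσ
    have hF := hE.continuous_radialCdf (hfst ▸ hFX)
    have hσX := hE.fst_scale_pos (hfst ▸ hFX)
    have hσX' := hE'.fst_scale_pos (hfst' ▸ hFX')
    obtain ⟨q, hq⟩ : ∃ q, radialCdf ν q = α := exists_cdf_eq hF hα
    have hx := (hE.cdf_fst hσX q).trans hq
    have hx' := (hE'.cdf_fst hσX' q).trans hq
    refine CoVaR_le_CoVaR hX hY hX' hY' hFX hFX' hα hβ (hfst ▸ hx) (hfst' ▸ hx')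
      fun y' hy' => ?_
    have h1α : 0 < 1 - α := sub_pos.2 hα.2
    rcases eq_or_lt_of_le hE.2.1 with h0 | hσY
    · subst h0
      rw [← hsnd', hE'.snd_eq_dirac] at hy'
      have hy : μY' ≤ y' := le_of_cdf_dirac_pos ((mul_pos hβ.1 h1α).trans_le
        (hy'.trans (sub_le_self _ measureReal_nonneg)))
      refine ⟨μY, hμ.trans hy, (mul_le_of_le_one_left h1α.le hβ.2.le).trans ?_⟩
      rw [← hsnd]
      exact one_sub_le_of_snd_eq_dirac hE.snd_eq_dirac hx
    · obtain ⟨u, v, hu, hv, huv, hJ⟩ := hE.exists_projCdf hσX hσY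
      obtain ⟨u', v', hu', hv', huv', hJ'⟩ := hE'.exists_projCdf hσX' hσY
      obtain ⟨z, rfl⟩ : ∃ z, μY' + σY * z = y' := ⟨(y' - μY') / σY, by field_simp; ring⟩
      refine ⟨μY + σY * z, by linarith, hy'.trans ?_⟩
      rw [← hsnd, ← hsnd', hE.cdf_snd hσY, hE'.cdf_snd hσY, hJ, hJ']
      exact sub_le_sub_left (projCdf_le ν hu hv hu' hv' (by rw [huv, huv']; exact hρ) q z) _
  · intro μX μY σX σY μX' μY' σX' σY' hE hE' hμ hσ C hC hC0 α hα β hβ hmed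
    have hF := hE.continuous_radialCdf (hfst ▸ hFX)
    have hσX := hE.fst_scale_pos (hfst ▸ hFX)
    have hσX' := hE'.fst_scale_pos (hfst' ▸ hFX')
    obtain ⟨q, hq⟩ : ∃ q, radialCdf ν q = α := exists_cdf_eq hF hα
    have hx := (hE.cdf_fst hσX q).trans hq
    have hx' := (hE'.cdf_fst hσX' q).trans hq
    refine CoVaR_le_CoVaR hX hY hX' hY' hFX hFX' hα hβ (hfst ▸ hx) (hfst' ▸ hx')
      fun y' hy' => ?_
    have h1α : 0 < 1 - α := sub_pos.2 hα.2
    rcases eq_or_lt_of_le hE'.2.1 with h0 | hσY'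
    · subst h0
      obtain rfl : σY = 0 := le_antisymm hσ hE.2.1
      rw [← hsnd', hE'.snd_eq_dirac] at hy'
      have hy : μY' ≤ y' := le_of_cdf_dirac_pos ((mul_pos hβ.1 h1α).trans_le
        (hy'.trans (sub_le_self _ measureReal_nonneg)))
      refine ⟨μY, hμ.trans hy, (mul_le_of_le_one_left h1α.le hβ.2.le).trans ?_⟩
      rw [← hsnd]
      exact one_sub_le_of_snd_eq_dirac hE.snd_eq_dirac hx
    · obtain ⟨u', v', hu', hv', huv', hJ'⟩ := hE'.exists_projCdf hσX' hσY'
      -- For `σY = 0` the unit vectors come from the elliptical copula, which in particular ensures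
      -- that `|ρ| ≤ 1`.
      obtain ⟨u, v, hu, hv, huv, hJC⟩ : ∃ u v : ℝ × ℝ, planeDot u u = 1 ∧ planeDot v v = 1 ∧
          planeDot u v = ρ ∧
          ∀ x y, C (radialCdf ν x) (radialCdf ν y) = projCdf ν u v x y := by
        rcases eq_or_lt_of_le hE.2.1 with h0 | hσY
        · exact (hC0 h0.symm).exists_projCdf.2
        · exact hC.exists_projCdf hE hσX hσY
      have hle : planeDot u v ≤ planeDot u' v' := by rw [huv, huv']; exact hρ
      obtain ⟨z, rfl⟩ : ∃ z, μY' + σY' * z = y' := ⟨(y' - μY') / σY', by field_simp; ring⟩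
      rw [← hsnd', hE'.cdf_snd hσY', hJ'] at hy'
      have hz : 0 ≤ z := by
        -- The median level `1 / 2` of `Y` is the value of the radial distribution function at `0`.
        rw [← radialCdf_zero ν hF, ← hq, hJC] at hmed
        rw [← hq] at hy'
        exact nonneg_of_median_level_le ν hν hF hu hv hu' hv' hle (hq.trans_lt hα.2) hβ hmed hy'
      rcases eq_or_lt_of_le hE.2.1 with h0 | hσY
      · subst h0
        refine ⟨μY, by nlinarith, (mul_le_of_le_one_left h1α.le hβ.2.le).trans ?_⟩
        rw [← hsnd]
        exact one_sub_le_of_snd_eq_dirac hE.snd_eq_dirac hx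
      · refine ⟨μY + σY * z, add_le_add hμ (mul_le_mul_of_nonneg_right hσ hz), hy'.trans ?_⟩
        have hJ : (P.map fun ω => (X ω, Y ω)).real
            (Set.Iic (μX + σX * q) ×ˢ Set.Iic (μY + σY * z)) = projCdf ν u v q z := by
          rw [hC.2, hE.cdf_fst hσX, hE.cdf_snd hσY, hJC]
        rw [← hsnd, hE.cdf_snd hσY, hJ]
        exact sub_le_sub_left (projCdf_le ν hu hv hu' hv' hle q z) _
  · intro C C' hC hEC hC' hEC' hY_le α hα β hβ
    obtain ⟨x, hx⟩ := exists_cdf_eq hFX hα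
    obtain ⟨x', hx'⟩ := exists_cdf_eq hFX' hα
    refine CoVaR_le_CoVaR hX hY hX' hY' hFX hFX' hα hβ hx hx' fun y hy =>
      ⟨y, le_rfl, hy.trans ?_⟩
    rw [hC.2, hC'.2, hfst, hsnd, hfst', hsnd', hx, hx']
    have hI : cdf (P.map Y) y ∈ Set.Icc (0 : ℝ) 1 := ⟨cdf_nonneg _ _, cdf_le_one _ _⟩
    have hI' : cdf (P'.map Y') y ∈ Set.Icc (0 : ℝ) 1 := ⟨cdf_nonneg _ _, cdf_le_one _ _⟩
    calc cdf (P'.map Y') y - C' α (cdf (P'.map Y') y)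
        ≤ cdf (P.map Y) y - C' α (cdf (P.map Y) y) :=
          hC'.1.sub_le_sub (Set.Ioo_subset_Icc_self hα) hI' hI (hY_le y)
      _ ≤ cdf (P.map Y) y - C α (cdf (P.map Y) y) :=
          sub_le_sub_left (hEC.le hEC' hρ hα hI) _
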